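/- Let $F$ be a field and $G$ a finite simple graph. A weighting $f:V(G)\to F$ is \emph{well-covered} if $\sum_{v\in M}f(v)$ has the same value for every maximal independent set $M$ of $G$; the well-covered weightings form a vector space over $F$, whose dimension is the \emph{well-covered dimension} $\mathrm{wcdim}(G,F)$. A vertex $v$ is \emph{simplicial} if its closed neighborhood $N[v]$ is a maximal clique. A \emph{simplicial clique} is a maximal clique containing a simplicial vertex, and the \emph{simplicial clique number} $sc(G)$ is the number of simplicial cliques. The Sierpinski gasket graphs $S_n$ ($n\ge 1$) are defined recursively: $S_1=K_3$ is a triangle of side length $1$ in the plane, and $S_{n+1}$, which fills a triangle of side length $2^{n}$, is the union of three translates of $S_n$ placed at the corners of that triangle, any two of them sharing exactly one corner vertex. A \emph{corner clique} of $S_n$ is the closed neighborhood of one of its three corner vertices. Theorem. For every field $F$ (of any characteristic) and every $n\ge 3$: (i) $\mathrm{wcdim}(S_n,F)=3$; (ii) $sc(S_n)=3$, and the simplicial cliques of $S_n$ are exactly its three corner cliques; (iii) every well-covered weighting $f:V(S_n)\to F$ satisfies $f(v)=0$ for every vertex $v$ outside the three corner cliques, and $f$ is constant on each corner clique. -/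

import Mathlib

/-! ### Well-covered weightings of a finite graph -/

/-- A finite set of vertices is a maximal independent set (MIS) if it is independent and is not
properly contained in any independent set. -/
def SimpleGraph.IsMIS {V : Type*} (G : SimpleGraph V) (M : Finset V) : Prop :=
  Maximal (fun s : Finset V => G.IsIndepSet (s : Set V)) M

/-- A weighting `f : V → F` is well-covered if the sum of `f` over `M` is the same for every
maximal independent set `M`. -/
def SimpleGraph.IsWellCoveredWeighting {V : Type*} (G : SimpleGraph V) {F : Type*} [Field F]
    (f : V → F) : Prop :=
  ∃ c : F, ∀ M : Finset V, G.IsMIS M → ∑ v ∈ M, f v = c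

/-- The vector space over `F` of all well-covered weightings of `G`. -/
def SimpleGraph.wellCoveredSpace {V : Type*} (G : SimpleGraph V) (F : Type*) [Field F] :
    Submodule F (V → F) where
  carrier := {f | G.IsWellCoveredWeighting f}
  zero_mem' := ⟨0, fun M _ => by simp⟩
  add_mem' := by
    rintro f g ⟨c, hc⟩ ⟨d, hd⟩
    refine ⟨c + d, fun M hM => ?_⟩
    simp only [Pi.add_apply, Finset.sum_add_distrib, hc M hM, hd M hM]
  smul_mem' := by
    rintro a f ⟨c, hc⟩
    refine ⟨a * c, fun M hM => ?_⟩
    simp only [Pi.smul_apply, smul_eq_mul, ← Finset.mul_sum, hc M hM]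

/-- The well-covered dimension of `G` over `F`. -/
noncomputable def SimpleGraph.wcdim {V : Type*} (G : SimpleGraph V) (F : Type*) [Field F] : ℕ :=
  Module.finrank F (G.wellCoveredSpace F)

/-! ### Simplicial cliques -/

/-- The closed neighborhood `N[v]`. -/
def SimpleGraph.closedNbhd {V : Type*} (G : SimpleGraph V) (v : V) : Set V :=
  insert v (G.neighborSet v)

/-- A vertex is simplicial if its closed neighborhood is a maximal clique. -/
def SimpleGraph.IsSimplicialVertex {V : Type*} (G : SimpleGraph V) (v : V) : Prop :=
  Maximal G.IsClique (G.closedNbhd v)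

/-- The simplicial cliques: the maximal cliques that contain at least one simplicial vertex. -/
def SimpleGraph.simplicialCliques {V : Type*} (G : SimpleGraph V) : Set (Set V) :=
  {C | Maximal G.IsClique C ∧ ∃ v ∈ C, G.IsSimplicialVertex v}

/-- The simplicial clique number. -/
noncomputable def SimpleGraph.sc {V : Type*} (G : SimpleGraph V) : ℕ :=
  G.simplicialCliques.ncard

/-! ### Sierpinski gasket graphs

A pair `(a, b)` of natural numbers stands for the point `a • (1, 0) + b • (1/2, √3/2)` of the
plane. In these coordinates the graph `S_n` fills a triangle of side length `2 ^ (n - 1)` with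
corners `(0, 0)`, `(2 ^ (n - 1), 0)` and `(0, 2 ^ (n - 1))`. The graph `S_1` is a triangle, and
`S_{n+1}` is the union of three translated copies of `S_n`, any two of which share exactly one
corner. The index `0` is not used; it gives the empty graph. -/

/-- The vertices of the Sierpinski gasket graph `S_n`. -/
def sierpinskiVerts : ℕ → Finset (ℕ × ℕ)
  | 0 => ∅
  | 1 => {(0, 0), (1, 0), (0, 1)}
  | n + 2 =>
      sierpinskiVerts (n + 1) ∪
      (sierpinskiVerts (n + 1)).map (addRightEmbedding (2 ^ n, 0)) ∪
      (sierpinskiVerts (n + 1)).map (addRightEmbedding (0, 2 ^ n))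

/-- The edges of the Sierpinski gasket graph `S_n`, as a graph on all of `ℕ × ℕ`. -/
def sierpinskiEdges : ℕ → SimpleGraph (ℕ × ℕ)
  | 0 => ⊥
  | 1 => SimpleGraph.fromRel fun p q => p ∈ sierpinskiVerts 1 ∧ q ∈ sierpinskiVerts 1
  | n + 2 =>
      sierpinskiEdges (n + 1) ⊔
      (sierpinskiEdges (n + 1)).map (addRightEmbedding (2 ^ n, 0)) ⊔
      (sierpinskiEdges (n + 1)).map (addRightEmbedding (0, 2 ^ n))

/-- The Sierpinski gasket graph `S_n`. -/
def sierpinskiGasket (n : ℕ) : SimpleGraph (sierpinskiVerts n) :=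
  (sierpinskiEdges n).induce (sierpinskiVerts n : Set (ℕ × ℕ))

/-- The corner cliques of `S_n`: the closed neighborhoods of the three corner vertices, that is,
the unit triangles at the three corners. -/
def sierpinskiCornerCliques (n : ℕ) : Set (Set (sierpinskiVerts n)) :=
  {C | ∃ v : sierpinskiVerts n,
    ((v : ℕ × ℕ) = (0, 0) ∨ (v : ℕ × ℕ) = (2 ^ (n - 1), 0) ∨ (v : ℕ × ℕ) = (0, 2 ^ (n - 1))) ∧
    C = (sierpinskiGasket n).closedNbhd v}

/-! For `n ≥ 2`, `S_n` is a union of copies of `S_2`: triangles subdivided at the midpoints of their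
sides, indexed by the cells of `S_{n-1}`. A corner lies in at most two blocks, and the corners in
only one block are the three outer corners. The structure `TriangleBlocks` records what the graph
argument needs.

The tool is an exchange principle, `IsWellCoveredWeighting.sum_eq_sum`: independent sets with equal
closed neighborhoods extend to maximal independent sets by the same vertices, so they have equal
weight. Let `P`, `Q` be shared corners of a block and `x` the midpoint between them. Exchanges give
`f P + f Q = f x`, `f P = f x` and `f Q = f x`; hence all three vanish, in every characteristic.
Another exchange makes `f` constant on the clique at an outer corner.

If no block has two unshared corners, which is true for `n ≥ 3`, this determines `f` from its values
at the outer corners. Conversely, indicators of the simplicial cliques are well-covered, so these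
values are arbitrary and the dimension is three. The geometry of the gasket is checked through
binary digits of cell coordinates. -/

namespace SimpleGraph

variable {V : Type*} {G : SimpleGraph V}

/-! ### Maximal independent sets and the exchange principle. -/

theorem IsMIS.exists_adj {M : Finset V} (hM : G.IsMIS M) {v : V} (hv : v ∉ M) :
    ∃ u ∈ M, G.Adj u v := by
  classical
  by_contra! h
  have hind : G.IsIndepSet (M : Set V) := hM.prop
  have : G.IsIndepSet ((insert v M : Finset V) : Set V) := by
    intro a ha b hb hab hadj
    simp only [Finset.coe_insert, Set.mem_insert_iff, Finset.mem_coe] at ha hb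
    rcases ha with rfl | ha <;> rcases hb with rfl | hb
    · exact hab rfl
    · exact h b hb hadj.symm
    · exact h a ha hadj
    · exact hind ha hb hab hadj
  exact hv (hM.le_of_ge this (Finset.subset_insert v M) (Finset.mem_insert_self v M))

theorem isMIS_of_forall_exists_adj {M : Finset V} (hM : G.IsIndepSet (M : Set V))
    (h : ∀ v ∉ M, ∃ u ∈ M, G.Adj u v) : G.IsMIS M := by
  refine ⟨hM, fun N hN hMN v hv => ?_⟩
  by_contra hvM
  obtain ⟨u, hu, huv⟩ := h v hvM
  exact hN (hMN hu) hv huv.ne huv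

theorem exists_isMIS_superset [Finite V] {S : Finset V} (hS : G.IsIndepSet (S : Set V)) :
    ∃ M, S ⊆ M ∧ G.IsMIS M :=
  Finite.exists_le_maximal (p := fun s : Finset V => G.IsIndepSet (s : Set V)) hS

/-- Independent sets with the same closed neighborhood have the same weight under every
well-covered weighting. -/
theorem IsWellCoveredWeighting.sum_eq_sum [Finite V] {F : Type*} [Field F] {f : V → F}
    (hf : G.IsWellCoveredWeighting f) {S T : Finset V}
    (hS : G.IsIndepSet (S : Set V)) (hT : G.IsIndepSet (T : Set V))
    (hST : ∀ u ∈ S, ∀ v, v = u ∨ G.Adj u v → ∃ w ∈ T, v = w ∨ G.Adj w v)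
    (hTS : ∀ u ∈ T, ∀ v, v = u ∨ G.Adj u v → ∃ w ∈ S, v = w ∨ G.Adj w v) :
    ∑ v ∈ S, f v = ∑ v ∈ T, f v := by
  classical
  obtain ⟨M, hSM, hM⟩ := exists_isMIS_superset hS
  obtain ⟨c, hc⟩ := hf
  have hMi : G.IsIndepSet (M : Set V) := hM.prop
  have far : ∀ x ∈ M \ S, ∀ u ∈ T, ¬ (x = u ∨ G.Adj u x) := by
    intro x hx u hu hux
    rw [Finset.mem_sdiff] at hx
    obtain ⟨w, hw, hwx⟩ := hTS u hu x hux
    rcases hwx with rfl | hwx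
    · exact hx.2 hw
    · exact hMi (hSM hw) hx.1 hwx.ne hwx
  -- Replacing `S` by `T` inside `M` preserves both independence and domination, because `S` and `T`
  -- dominate the same vertices.
  have hM' : G.IsMIS (T ∪ M \ S) := by
    refine isMIS_of_forall_exists_adj ?_ ?_
    · intro a ha b hb hab hadj
      rw [Finset.mem_coe, Finset.mem_union] at ha hb
      rcases ha with ha | ha <;> rcases hb with hb | hb
      · exact hT ha hb hab hadj
      · exact far b hb a ha (.inr hadj)
      · exact far a ha b hb (.inr hadj.symm)
      · exact hMi (Finset.mem_sdiff.1 ha).1 (Finset.mem_sdiff.1 hb).1 hab hadj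
    · intro v hv
      rw [Finset.mem_union, not_or, Finset.mem_sdiff, not_and, not_not] at hv
      have key : ∀ u ∈ S, v = u ∨ G.Adj u v → ∃ w ∈ T ∪ M \ S, G.Adj w v := by
        intro u hu huv
        obtain ⟨w, hw, hwv⟩ := hST u hu v huv
        rcases hwv with rfl | hwv
        · exact absurd hw hv.1
        · exact ⟨w, Finset.mem_union_left _ hw, hwv⟩
      by_cases hvM : v ∈ M
      · exact key v (hv.2 hvM) (.inl rfl)
      · obtain ⟨u, hu, huv⟩ := hM.exists_adj hvM
        by_cases huS : u ∈ S
        · exact key u huS (.inr huv)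
        · exact ⟨u, Finset.mem_union_right _ (Finset.mem_sdiff.2 ⟨hu, huS⟩), huv⟩
  have h1 := hc M hM
  have h2 := hc _ hM'
  rw [Finset.sum_union
    (Finset.disjoint_left.2 fun u hu hx => far u hx u hu (.inl rfl))] at h2
  rw [← Finset.sum_sdiff hSM] at h1
  have := h1.trans h2.symm
  rw [add_comm] at this
  exact add_right_cancel this

theorem isIndepSet_insert_iff {a : V} {s : Set V} :
    G.IsIndepSet (insert a s) ↔ (∀ b ∈ s, ¬ G.Adj a b) ∧ G.IsIndepSet s := by
  constructor
  · exact fun h => ⟨fun b hb hab => h (Set.mem_insert _ _) (Set.mem_insert_of_mem _ hb) hab.ne hab,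
      h.mono (Set.subset_insert _ _)⟩
  · rintro ⟨h, hs⟩ x (rfl | hx) y (rfl | hy) hxy
    exacts [absurd rfl hxy, h y hy, fun hadj => h x hx hadj.symm, hs hx hy hxy]

/-! ### Simplicial vertices and simplicial cliques. -/

theorem IsClique.subset_closedNbhd {C : Set V} (hC : G.IsClique C) {v : V} (hv : v ∈ C) :
    C ⊆ G.closedNbhd v := by
  intro u hu
  by_cases huv : u = v
  · exact Set.mem_insert_iff.2 (.inl huv)
  · exact Set.mem_insert_iff.2 (.inr (hC hv hu (Ne.symm huv)))

/-- Maximality is automatic: any clique through `v` lies in its closed neighborhood. -/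
theorem isSimplicialVertex_iff {v : V} :
    G.IsSimplicialVertex v ↔ G.IsClique (G.closedNbhd v) :=
  ⟨fun h => h.prop, fun h => ⟨h, fun _ hD hle =>
    IsClique.subset_closedNbhd hD (hle (Set.mem_insert _ _))⟩⟩

theorem simplicialCliques_eq :
    G.simplicialCliques = {C | ∃ v, G.IsSimplicialVertex v ∧ C = G.closedNbhd v} := by
  ext C
  constructor
  · rintro ⟨hC, v, hvC, hv⟩
    refine ⟨v, hv, ?_⟩
    have := IsClique.subset_closedNbhd hC.prop hvC
    exact subset_antisymm this (hC.le_of_ge hv.prop this)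
  · rintro ⟨v, hv, rfl⟩
    exact ⟨hv, v, Set.mem_insert _ _, hv⟩

/-- Every maximal independent set meets the closed neighborhood of a simplicial vertex in exactly
one vertex. -/
theorem IsSimplicialVertex.sum_indicator {F : Type*} [Field F] {v : V}
    (hv : G.IsSimplicialVertex v) {M : Finset V} (hM : G.IsMIS M) :
    ∑ u ∈ M, (G.closedNbhd v).indicator (fun _ => (1 : F)) u = 1 := by
  classical
  have hind : G.IsIndepSet (M : Set V) := hM.prop
  obtain ⟨w, hw, hwv⟩ : ∃ w ∈ M, w ∈ G.closedNbhd v := by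
    by_cases hvM : v ∈ M
    · exact ⟨v, hvM, Set.mem_insert _ _⟩
    · obtain ⟨u, hu, huv⟩ := hM.exists_adj hvM
      exact ⟨u, hu, Set.mem_insert_iff.2 (.inr huv.symm)⟩
  rw [Finset.sum_eq_single_of_mem w hw, Set.indicator_of_mem hwv]
  intro u hu huw
  refine Set.indicator_of_notMem (fun huv => ?_) _
  exact hind hu hw huw (hv.prop huv hwv huw)

/-! ### Graphs decomposed into subdivided triangles. -/

/-- A decomposition of a graph into blocks, each of them a triangle subdivided at the midpoints
of its sides. Distinct blocks share at most one corner, and a corner lies in at most two blocks.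
The vertex `mid t k` is the midpoint opposite to `corner t k`. -/
structure TriangleBlocks (G : SimpleGraph V) (T : Type*) where
  corner : T → Fin 3 → V
  mid : T → Fin 3 → V
  exists_eq : ∀ v, ∃ t k, v = corner t k ∨ v = mid t k
  corner_ne_mid : ∀ s j t k, corner s j ≠ mid t k
  mid_inj : ∀ s j t k, mid s j = mid t k → s = t ∧ j = k
  corner_inj : ∀ t j k, corner t j = corner t k → j = k
  block_eq : ∀ s t j j' k k', j ≠ j' → corner s j = corner t k → corner s j' = corner t k' → s = t
  block_eq_of_three : ∀ r s t i j k, corner r i = corner t k → corner s j = corner t k →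
    r = s ∨ s = t ∨ r = t
  adj_mid_mid : ∀ s j t k, G.Adj (mid s j) (mid t k) ↔ s = t ∧ j ≠ k
  adj_corner_mid : ∀ s j t k, G.Adj (corner s j) (mid t k) ↔
    ∃ l, l ≠ k ∧ corner t l = corner s j
  not_adj_corner_corner : ∀ s j t k, ¬ G.Adj (corner s j) (corner t k)

namespace TriangleBlocks

variable {T : Type*} (B : G.TriangleBlocks T)

theorem exists_others (k : Fin 3) : ∃ l m : Fin 3, k ≠ l ∧ k ≠ m ∧ l ≠ m :=
  ⟨k + 1, k + 2, by omega, by omega, by omega⟩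

/-- A corner is shared if it also belongs to another block. -/
def Shared (t : T) (k : Fin 3) : Prop := ∃ s j, s ≠ t ∧ B.corner s j = B.corner t k

theorem adj_mid_corner (s : T) (j : Fin 3) (t : T) (k : Fin 3) :
    G.Adj (B.mid t k) (B.corner s j) ↔ ∃ l, l ≠ k ∧ B.corner t l = B.corner s j := by
  rw [G.adj_comm, B.adj_corner_mid]

theorem mid_eq_mid (s : T) (j : Fin 3) (t : T) (k : Fin 3) :
    B.mid s j = B.mid t k ↔ s = t ∧ j = k :=
  ⟨B.mid_inj s j t k, by rintro ⟨rfl, rfl⟩; rfl⟩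

theorem adj_shared_mid {s t : T} {i k : Fin 3} (hst : s ≠ t) (h : B.corner s i = B.corner t k)
    (x : T) (y : Fin 3) :
    G.Adj (B.corner t k) (B.mid x y) ↔ (x = t ∧ y ≠ k) ∨ (x = s ∧ y ≠ i) := by
  rw [B.adj_corner_mid]
  constructor
  · rintro ⟨l, hl, hx⟩
    rcases B.block_eq_of_three x s t l i k hx h with rfl | h' | rfl
    · have := B.corner_inj x l i (hx.trans h.symm)
      exact .inr ⟨rfl, this ▸ hl.symm⟩
    · exact absurd h' hst
    · have := B.corner_inj x l k hx
      exact .inl ⟨rfl, this ▸ hl.symm⟩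
  · rintro (⟨rfl, hy⟩ | ⟨rfl, hy⟩)
    · exact ⟨k, hy.symm, rfl⟩
    · exact ⟨i, hy.symm, h⟩

theorem adj_unshared_mid {t : T} {k : Fin 3} (h : ¬ B.Shared t k) (x : T) (y : Fin 3) :
    G.Adj (B.corner t k) (B.mid x y) ↔ x = t ∧ y ≠ k := by
  rw [B.adj_corner_mid]
  constructor
  · rintro ⟨l, hl, hx⟩
    by_cases hxt : x = t
    · subst hxt
      have := B.corner_inj x l k hx
      exact ⟨rfl, this ▸ hl.symm⟩
    · exact absurd ⟨x, l, hxt, hx⟩ h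
  · rintro ⟨rfl, hy⟩
    exact ⟨k, hy.symm, rfl⟩

theorem adj_mid_iff {t : T} {k l m : Fin 3} (hkl : k ≠ l) (hkm : k ≠ m) (hlm : l ≠ m) {v : V} :
    G.Adj (B.mid t m) v ↔
      v = B.mid t k ∨ v = B.mid t l ∨ v = B.corner t k ∨ v = B.corner t l := by
  have hall : ∀ x : Fin 3, x = k ∨ x = l ∨ x = m := by omega
  obtain ⟨x, z, rfl | rfl⟩ := B.exists_eq v
  · simp only [B.adj_mid_corner, B.corner_ne_mid, false_or]
    constructor
    · rintro ⟨y, hy, h⟩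
      rcases hall y with rfl | rfl | rfl
      exacts [.inl h.symm, .inr h.symm, absurd rfl hy]
    · rintro (h | h)
      exacts [⟨k, hkm, h.symm⟩, ⟨l, hlm, h.symm⟩]
  · simp only [B.adj_mid_mid, B.mid_eq_mid, (B.corner_ne_mid _ _ _ _).symm, or_false]
    have := hall z
    grind

theorem adj_shared_iff {s t : T} {i j₁ j₂ k l m : Fin 3} (hst : s ≠ t)
    (h : B.corner s i = B.corner t k) (hkl : k ≠ l) (hkm : k ≠ m) (hlm : l ≠ m)
    (hi₁ : i ≠ j₁) (hi₂ : i ≠ j₂) (hj : j₁ ≠ j₂) {v : V} :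
    G.Adj (B.corner t k) v ↔
      v = B.mid t l ∨ v = B.mid t m ∨ v = B.mid s j₁ ∨ v = B.mid s j₂ := by
  obtain ⟨x, z, rfl | rfl⟩ := B.exists_eq v
  · simp only [B.not_adj_corner_corner, B.corner_ne_mid, or_false]
  · simp only [B.adj_shared_mid hst h, B.mid_eq_mid]
    have : z = k ∨ z = l ∨ z = m := by omega
    have : z = i ∨ z = j₁ ∨ z = j₂ := by omega
    grind

theorem adj_unshared_iff {t : T} {k l m : Fin 3} (h : ¬ B.Shared t k)
    (hkl : k ≠ l) (hkm : k ≠ m) (hlm : l ≠ m) {v : V} :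
    G.Adj (B.corner t k) v ↔ v = B.mid t l ∨ v = B.mid t m := by
  obtain ⟨x, z, rfl | rfl⟩ := B.exists_eq v
  · simp only [B.not_adj_corner_corner, B.corner_ne_mid, or_false]
  · simp only [B.adj_unshared_mid h, B.mid_eq_mid]
    have : z = k ∨ z = l ∨ z = m := by omega
    grind

/-! ### Exchange relations in a block with two shared corners. -/

variable {F : Type*} [Field F] {f : V → F} [Finite V]

/-- Exchange the two corners for the midpoint between them. The auxiliary `mid s i` and `mid r j`,
opposite the shared corners in the neighboring blocks, dominate the neighbors of these corners
there. -/
theorem add_eq (hf : G.IsWellCoveredWeighting f) {t : T} {k l m : Fin 3} (hkl : k ≠ l)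
    (hkm : k ≠ m) (hlm : l ≠ m) (hk : B.Shared t k) (hl : B.Shared t l) :
    f (B.corner t k) + f (B.corner t l) = f (B.mid t m) := by
  classical
  -- The neighboring blocks `s` and `r` differ, since a block sharing both corners with `t` would be
  -- `t`.
  obtain ⟨s, i, hst, hs⟩ := hk
  obtain ⟨r, j, hrt, hr⟩ := hl
  have hsr : s ≠ r := fun h => hst (B.block_eq s t i j k l
    (fun hij => hkl (B.corner_inj t k l (by rw [← hs, ← hr, h, hij]))) hs (by rw [h, hr]))
  obtain ⟨i₁, i₂, hi₁, hi₂, hi⟩ := exists_others i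
  obtain ⟨j₁, j₂, hj₁, hj₂, hj⟩ := exists_others j
  have hP (v) := B.adj_shared_iff (v := v) hst hs hkl hkm hlm hi₁ hi₂ hi
  have hQ (v) := B.adj_shared_iff (v := v) hrt hr hkl.symm hlm hkm hj₁ hj₂ hj
  have hm (v) := B.adj_mid_iff (t := t) (v := v) hkl hkm hlm
  have hp (v) := B.adj_mid_iff (t := s) (v := v) hi hi₁.symm hi₂.symm
  have hq (v) := B.adj_mid_iff (t := r) (v := v) hj hj₁.symm hj₂.symm
  have hcm := B.corner_ne_mid
  have hmm := B.mid_inj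
  have hcc := B.corner_inj
  have h := hf.sum_eq_sum
    (S := {B.corner t k, B.corner t l, B.mid s i, B.mid r j})
    (T := {B.mid t m, B.mid s i, B.mid r j}) ?_ ?_ ?_ ?_
  · rw [Finset.sum_insert (a := B.corner t k), Finset.sum_insert (a := B.corner t l),
      Finset.sum_insert (a := B.mid t m), ← add_assoc] at h
    · exact add_right_cancel h
    all_goals
      simp only [Finset.mem_insert, Finset.mem_singleton]
      grind
  all_goals simp only [Finset.coe_insert, Finset.coe_singleton, isIndepSet_insert_iff,
      Set.pairwise_singleton, IsIndepSet, Set.mem_insert_iff, Set.mem_singleton_iff, and_true,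
      Finset.mem_insert, Finset.mem_singleton, exists_eq_or_imp, exists_eq_left,
      forall_eq_or_imp, forall_eq, hP, hQ, hm, hp, hq]
  all_goals clear hP hQ hm hp hq
  · grind
  · grind
  all_goals
    clear hcm hmm hcc
    grind

/-- Exchange one corner for the midpoint. `mid s i` dominates the neighbors of the corner in `s`,
`mid r j₁` dominates the other shared corner, and `corner t m` dominates the midpoint opposite
`corner t k`. -/
theorem eq_of_shared (hf : G.IsWellCoveredWeighting f) {t : T} {k l m : Fin 3} (hkl : k ≠ l)
    (hkm : k ≠ m) (hlm : l ≠ m) (hk : B.Shared t k) (hl : B.Shared t l) :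
    f (B.corner t k) = f (B.mid t m) := by
  classical
  obtain ⟨s, i, hst, hs⟩ := hk
  obtain ⟨r, j, hrt, hr⟩ := hl
  have hsr : s ≠ r := fun h => hst (B.block_eq s t i j k l
    (fun hij => hkl (B.corner_inj t k l (by rw [← hs, ← hr, h, hij]))) hs (by rw [h, hr]))
  obtain ⟨i₁, i₂, hi₁, hi₂, hi⟩ := exists_others i
  obtain ⟨j₁, j₂, hj₁, hj₂, hj⟩ := exists_others j
  have hP (v) := B.adj_shared_iff (v := v) hst hs hkl hkm hlm hi₁ hi₂ hi
  have hm (v) := B.adj_mid_iff (t := t) (v := v) hkl hkm hlm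
  have hp (v) := B.adj_mid_iff (t := s) (v := v) hi hi₁.symm hi₂.symm
  have hq (v) := B.adj_mid_iff (t := r) (v := v) hj₂ hj₁ hj.symm
  have hcm := B.corner_ne_mid
  have hmm := B.mid_inj
  have hcc := B.corner_inj
  have hbs := B.block_eq s t i
  have hbr := B.block_eq r t j
  have hmk := B.adj_corner_mid t m t k
  have hml := B.adj_corner_mid t m t l
  -- Needed for independence: otherwise `mid r j₁` would be adjacent to `corner t m`.
  have hT : ¬ (B.corner t m = B.corner r j₂) := fun h => hrt (hbr j₂ l m hj₂ hr h.symm)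
  have h := hf.sum_eq_sum
    (S := {B.corner t k, B.mid s i, B.mid r j₁, B.corner t m})
    (T := {B.mid t m, B.mid s i, B.mid r j₁, B.corner t m}) ?_ ?_ ?_ ?_
  · rw [Finset.sum_insert (a := B.corner t k),
      Finset.sum_insert (a := B.mid t m)] at h
    · exact add_right_cancel h
    all_goals
      simp only [Finset.mem_insert, Finset.mem_singleton]
      grind
  all_goals simp only [Finset.coe_insert, Finset.coe_singleton, isIndepSet_insert_iff,
      Set.pairwise_singleton, IsIndepSet, Set.mem_insert_iff, Set.mem_singleton_iff, and_true,
      Finset.mem_insert, Finset.mem_singleton, exists_eq_or_imp, exists_eq_left,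
      forall_eq_or_imp, forall_eq, hP, hm, hp, hq]
  all_goals clear hP hm hp hq
  · grind
  · grind
  all_goals
    clear hcm hmm hcc hbs hbr
    grind

end TriangleBlocks
end SimpleGraph

/-! ### Dimension count from simplicial vertices. -/

namespace SimpleGraph

variable {V : Type*} {G : SimpleGraph V}

theorem mem_closedNbhd_self (v : V) : v ∈ G.closedNbhd v := Set.mem_insert _ _

theorem mem_closedNbhd_iff {u v : V} : u ∈ G.closedNbhd v ↔ u = v ∨ G.Adj v u := Iff.rfl

/-- If the closed neighborhoods of the simplicial vertices in `K` are pairwise disjoint and a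
well-covered weighting is determined by its values on `K`, then the well-covered dimension is the
cardinality of `K`. -/
theorem wcdim_eq_ncard [Finite V] {F : Type*} [Field F] {K : Set V}
    (hK : ∀ v ∈ K, G.IsSimplicialVertex v)
    (hdisj : ∀ u ∈ K, ∀ v ∈ K, u ∈ G.closedNbhd v → u = v)
    (hzero : ∀ f : V → F, G.IsWellCoveredWeighting f → (∀ v ∈ K, f v = 0) → f = 0) :
    G.wcdim F = K.ncard := by
  classical
  have := Fintype.ofFinite K
  let φ : G.wellCoveredSpace F →ₗ[F] (K → F) :=
    (LinearMap.funLeft F F (Subtype.val : K → V)).comp (G.wellCoveredSpace F).subtype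
  have hinj : Function.Injective φ := by
    rw [← LinearMap.ker_eq_bot, LinearMap.ker_eq_bot']
    rintro ⟨f, hf⟩ h
    exact Subtype.ext (hzero f hf fun v hv => congrFun h ⟨v, hv⟩)
  have hsurj : Function.Surjective φ := by
    intro g
    -- No vertex of `K` lies in the closed neighborhood of another, so this combination of
    -- indicators restricts to `g` on `K`.
    refine ⟨⟨∑ w : K, g w • (G.closedNbhd w.1).indicator (fun _ => 1), ?_⟩, ?_⟩
    · exact Submodule.sum_mem _ fun w _ => Submodule.smul_mem _ _
        ⟨1, fun M hM => (hK w w.2).sum_indicator hM⟩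
    · ext v
      change (∑ w : K, g w • (G.closedNbhd w.1).indicator (fun _ => (1 : F))) v.1 = g v
      rw [Finset.sum_apply, Finset.sum_eq_single v]
      · simp [Set.indicator_of_mem (mem_closedNbhd_self v.1)]
      · intro w _ hwv
        rw [Pi.smul_apply, Set.indicator_of_notMem, smul_zero]
        exact fun h => hwv (Subtype.ext (hdisj v v.2 w w.2 h).symm)
      · exact fun h => absurd (Finset.mem_univ v) h
  rw [wcdim, (LinearEquiv.ofBijective φ ⟨hinj, hsurj⟩).finrank_eq,
    Module.finrank_fintype_fun_eq_card, ← Nat.card_eq_fintype_card, Nat.card_coe_set_eq]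

/-! ### Simplicial cliques and weightings of a block decomposition. -/

namespace TriangleBlocks

variable {T : Type*} (B : G.TriangleBlocks T)

/-- The vertices that are corners of only one block. -/
def outerCorners : Set V := {v | ∃ t k, ¬ B.Shared t k ∧ v = B.corner t k}

/-- A shared corner has nonadjacent neighbors in its two blocks, and a midpoint is adjacent to two
corners, which are never adjacent. An unshared corner sees only two adjacent midpoints. -/
theorem isSimplicialVertex_iff_mem_outerCorners {v : V} :
    G.IsSimplicialVertex v ↔ v ∈ B.outerCorners := by
  rw [isSimplicialVertex_iff]
  constructor
  · intro h
    obtain ⟨t, k, rfl | rfl⟩ := B.exists_eq v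
    · refine ⟨t, k, ?_, rfl⟩
      rintro ⟨s, i, hst, hs⟩
      obtain ⟨l, m, hkl, hkm, hlm⟩ := exists_others k
      obtain ⟨j₁, j₂, hj₁, hj₂, hj⟩ := exists_others i
      have hP (v) := B.adj_shared_iff (v := v) hst hs hkl hkm hlm hj₁ hj₂ hj
      have := h (x := B.mid t l) (.inr ((hP _).2 (.inl rfl)))
        (y := B.mid s j₁) (.inr ((hP _).2 (.inr (.inr (.inl rfl)))))
        (fun h => hst (B.mid_inj _ _ _ _ h).1.symm)
      exact hst ((B.adj_mid_mid _ _ _ _).1 this).1.symm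
    · obtain ⟨l, m, hkl, hkm, hlm⟩ := exists_others k
      have hm (v) := B.adj_mid_iff (t := t) (v := v) hlm hkl.symm hkm.symm
      exact absurd (h (x := B.corner t l) (.inr ((hm _).2 (by simp)))
        (y := B.corner t m) (.inr ((hm _).2 (by simp)))
        (fun h => hlm (B.corner_inj _ _ _ h))) (B.not_adj_corner_corner _ _ _ _)
  · rintro ⟨t, k, hk, rfl⟩
    obtain ⟨l, m, hkl, hkm, hlm⟩ := exists_others k
    have hP (v) := B.adj_unshared_iff (v := v) hk hkl hkm hlm
    have hmid : G.Adj (B.mid t l) (B.mid t m) := (B.adj_mid_mid _ _ _ _).2 ⟨rfl, hlm⟩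
    intro x hx y hy hxy
    rw [mem_closedNbhd_iff] at hx hy
    rcases hx with rfl | hx
    · exact hy.resolve_left (Ne.symm hxy)
    rcases hy with rfl | hy
    · exact hx.symm
    rcases (hP _).1 hx with rfl | rfl <;> rcases (hP _).1 hy with rfl | rfl
    exacts [absurd rfl hxy, hmid, hmid.symm, absurd rfl hxy]

theorem simplicialCliques_eq_image :
    G.simplicialCliques = G.closedNbhd '' B.outerCorners := by
  rw [simplicialCliques_eq]
  ext C
  simp only [B.isSimplicialVertex_iff_mem_outerCorners, Set.mem_image, Set.mem_ofPred_eq, eq_comm]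

theorem eq_of_mem_closedNbhd {u v : V} (hu : u ∈ B.outerCorners) (hv : v ∈ B.outerCorners)
    (h : u ∈ G.closedNbhd v) : u = v := by
  obtain ⟨t, k, -, rfl⟩ := hu
  obtain ⟨s, j, -, rfl⟩ := hv
  exact h.resolve_right (B.not_adj_corner_corner _ _ _ _)

theorem sc_eq_ncard : G.sc = B.outerCorners.ncard := by
  rw [sc, B.simplicialCliques_eq_image]
  refine Set.InjOn.ncard_image fun u hu v hv huv => B.eq_of_mem_closedNbhd hu hv ?_
  rw [← huv]
  exact mem_closedNbhd_self u

section Weighting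

variable {F : Type*} [Field F] {f : V → F} [Finite V]

/-- Exchange the outer corner for the midpoint. `corner t l` dominates the other two midpoints of
the block, and `mid r j₁` dominates the shared corner `corner t m` from the neighboring block. -/
theorem eq_mid_of_not_shared (hf : G.IsWellCoveredWeighting f) {t : T} {k l m : Fin 3}
    (hkl : k ≠ l) (hkm : k ≠ m) (hlm : l ≠ m) (hk : ¬ B.Shared t k) (hm : B.Shared t m) :
    f (B.corner t k) = f (B.mid t l) := by
  classical
  obtain ⟨r, j, hrt, hr⟩ := hm
  obtain ⟨j₁, j₂, hj₁, hj₂, hj⟩ := exists_others j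
  have hP (v) := B.adj_unshared_iff (v := v) hk hkl hkm hlm
  have hl (v) := B.adj_mid_iff (t := t) (v := v) hkm hkl hlm.symm
  have hq (v) := B.adj_mid_iff (t := r) (v := v) hj₂ hj₁ hj.symm
  have hcm := B.corner_ne_mid
  have hmm := B.mid_inj
  have hcc := B.corner_inj
  have hlk : G.Adj (B.corner t l) (B.mid t k) := (B.adj_corner_mid _ _ _ _).2 ⟨l, hkl.symm, rfl⟩
  have hlm' : G.Adj (B.corner t l) (B.mid t m) := (B.adj_corner_mid _ _ _ _).2 ⟨l, hlm, rfl⟩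
  have hT : ¬ (B.corner t l = B.corner r j₂) :=
    fun h => hrt (B.block_eq r t j j₂ m l hj₂ hr h.symm)
  have hT' : ¬ (B.corner t k = B.corner r j₂) :=
    fun h => hrt (B.block_eq r t j j₂ m k hj₂ hr h.symm)
  have h := hf.sum_eq_sum
    (S := {B.corner t k, B.mid r j₁, B.corner t l})
    (T := {B.mid t l, B.mid r j₁, B.corner t l}) ?_ ?_ ?_ ?_
  · rw [Finset.sum_insert (a := B.corner t k),
      Finset.sum_insert (a := B.mid t l)] at h
    · exact add_right_cancel h
    all_goals
      simp only [Finset.mem_insert, Finset.mem_singleton]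
      grind
  all_goals simp only [Finset.coe_insert, Finset.coe_singleton, isIndepSet_insert_iff,
      Set.pairwise_singleton, IsIndepSet, Set.mem_insert_iff, Set.mem_singleton_iff, and_true,
      Finset.mem_insert, Finset.mem_singleton, exists_eq_or_imp, exists_eq_left,
      forall_eq_or_imp, forall_eq, hP, hl, hq]
  all_goals clear hP hl hq
  · grind
  · grind
  all_goals
    clear hcm hmm hcc
    grind

theorem eq_zero_of_shared (hf : G.IsWellCoveredWeighting f) {t : T} {k l m : Fin 3} (hkl : k ≠ l)
    (hkm : k ≠ m) (hlm : l ≠ m) (hk : B.Shared t k) (hl : B.Shared t l) :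
    f (B.corner t k) = 0 ∧ f (B.mid t m) = 0 := by
  have h₁ := B.add_eq hf hkl hkm hlm hk hl
  have h₂ := B.eq_of_shared hf hkl hkm hlm hk hl
  have h₃ := B.eq_of_shared hf hkl.symm hlm hkm hl hk
  rw [h₂, h₃, add_eq_left] at h₁
  exact ⟨h₂.trans h₁, h₁⟩

-- At most one corner per block is unshared. This fails for `S_2`, a single block with three
-- unshared corners.
variable (hB : ∀ t k l, k ≠ l → B.Shared t k ∨ B.Shared t l)
include hB

theorem eq_zero_of_forall_notMem (hf : G.IsWellCoveredWeighting f) {v : V}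
    (hv : ∀ w ∈ B.outerCorners, v ∉ G.closedNbhd w) : f v = 0 := by
  obtain ⟨t, k, rfl | rfl⟩ := B.exists_eq v <;> obtain ⟨l, m, hkl, hkm, hlm⟩ := exists_others k
  · by_cases hk : B.Shared t k
    · rcases hB t l m hlm with hl | hm
      · exact (B.eq_zero_of_shared hf hkl hkm hlm hk hl).1
      · exact (B.eq_zero_of_shared hf hkm hkl hlm.symm hk hm).1
    · exact absurd (mem_closedNbhd_self _) (hv _ ⟨t, k, hk, rfl⟩)
  · have shared : ∀ j, j ≠ k → B.Shared t j := by
      intro j hj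
      by_contra h
      exact hv _ ⟨t, j, h, rfl⟩ (.inr ((B.adj_unshared_mid h _ _).2 ⟨rfl, hj.symm⟩))
    exact (B.eq_zero_of_shared hf hlm hkl.symm hkm.symm (shared l hkl.symm)
      (shared m hkm.symm)).2

theorem eq_of_mem_closedNbhd_outerCorner (hf : G.IsWellCoveredWeighting f) {v w : V}
    (hw : w ∈ B.outerCorners) (hv : v ∈ G.closedNbhd w) : f v = f w := by
  obtain ⟨t, k, hk, rfl⟩ := hw
  obtain ⟨l, m, hkl, hkm, hlm⟩ := exists_others k
  rcases hv with rfl | hv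
  · rfl
  rcases (B.adj_unshared_iff hk hkl hkm hlm).1 hv with rfl | rfl
  · exact (B.eq_mid_of_not_shared hf hkl hkm hlm hk ((hB t k m hkm).resolve_left hk)).symm
  · exact (B.eq_mid_of_not_shared hf hkm hkl hlm.symm hk ((hB t k l hkl).resolve_left hk)).symm

theorem wcdim_eq_ncard : G.wcdim F = B.outerCorners.ncard := by
  refine SimpleGraph.wcdim_eq_ncard
    (fun v hv => B.isSimplicialVertex_iff_mem_outerCorners.2 hv)
    (fun u hu v hv => B.eq_of_mem_closedNbhd hu hv) fun f hf h => funext fun v => ?_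
  by_cases hv : ∃ w ∈ B.outerCorners, v ∈ G.closedNbhd w
  · obtain ⟨w, hw, hvw⟩ := hv
    rw [B.eq_of_mem_closedNbhd_outerCorner hB hf hw hvw, h w hw, Pi.zero_apply]
  · push Not at hv
    exact B.eq_zero_of_forall_notMem hB hf hv

end Weighting

end TriangleBlocks
end SimpleGraph

/-! ### Binary arithmetic of the cells. -/

/-- The lower left vertices `(a, b)` of the upward unit triangles that make up the Sierpinski
gasket of side length `2 ^ k`: no binary digit is `1` in both `a` and `b`. -/
def IsSierpinskiCell : ℕ → ℕ → ℕ → Prop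
  | 0, a, b => a = 0 ∧ b = 0
  | k + 1, a, b => IsSierpinskiCell k (a / 2) (b / 2) ∧ ¬ (a % 2 = 1 ∧ b % 2 = 1)

namespace IsSierpinskiCell

theorem add_lt {k a b : ℕ} (h : IsSierpinskiCell k a b) : a + b < 2 ^ k := by
  induction k generalizing a b with
  | zero => obtain ⟨rfl, rfl⟩ := h; simp
  | succ k ih =>
    have := ih h.1
    have := h.2
    rw [pow_succ]
    omega

/-- The definition of a cell peels off the lowest binary digit, whereas the recursion for the gasket
peels off the highest. This reconciles them. -/
theorem succ_iff {k a b : ℕ} : IsSierpinskiCell (k + 1) a b ↔ IsSierpinskiCell k a b ∨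
    (2 ^ k ≤ a ∧ IsSierpinskiCell k (a - 2 ^ k) b) ∨
    (2 ^ k ≤ b ∧ IsSierpinskiCell k a (b - 2 ^ k)) := by
  induction k generalizing a b with
  | zero => simp only [IsSierpinskiCell]; omega
  | succ k ih =>
    rw [IsSierpinskiCell, ih]
    simp only [IsSierpinskiCell, pow_succ]
    have h₁ : (a - 2 ^ k * 2) / 2 = a / 2 - 2 ^ k := by omega
    have h₂ : (b - 2 ^ k * 2) / 2 = b / 2 - 2 ^ k := by omega
    have h₃ : 2 ^ k * 2 ≤ a ↔ 2 ^ k ≤ a / 2 := by omega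
    have h₄ : 2 ^ k * 2 ≤ b ↔ 2 ^ k ≤ b / 2 := by omega
    have h₅ : 2 ^ k * 2 ≤ a → (a - 2 ^ k * 2) % 2 = a % 2 := by omega
    have h₆ : 2 ^ k * 2 ≤ b → (b - 2 ^ k * 2) % 2 = b % 2 := by omega
    rw [h₁, h₂, ← h₃, ← h₄]
    clear ih h₁ h₂ h₃ h₄
    by_cases ha : 2 ^ k * 2 ≤ a <;> by_cases hb : 2 ^ k * 2 ≤ b <;>
      simp only [ha, hb, h₅, h₆, true_and, false_and, false_or, or_false] <;> tauto

/-- Infinite descent: the digit conditions force `a` and `b` to be odd, and halving then gives the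
same configuration one level down. Hence a vertex lies in at most two cells. -/
theorem not_three {k a b : ℕ} (h₁ : IsSierpinskiCell k (a + 1) (b + 1))
    (h₂ : IsSierpinskiCell k a (b + 1)) (h₃ : IsSierpinskiCell k (a + 1) b) : False := by
  induction k generalizing a b with
  | zero => exact absurd h₁.1 (by omega)
  | succ k ih =>
    obtain ⟨h₁, p₁⟩ := h₁
    obtain ⟨h₂, p₂⟩ := h₂
    obtain ⟨h₃, p₃⟩ := h₃
    obtain ⟨a, rfl⟩ : ∃ c, a = 2 * c + 1 := ⟨a / 2, by omega⟩
    obtain ⟨b, rfl⟩ : ∃ c, b = 2 * c + 1 := ⟨b / 2, by omega⟩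
    refine ih (a := a) (b := b) ?_ ?_ ?_
    · convert h₁ using 1 <;> omega
    · convert h₂ using 1 <;> omega
    · convert h₃ using 1 <;> omega

/-- A vertex of the gasket other than its three corners lies in at least two cells. -/
theorem two_of_one {k a b : ℕ} (h₀ : ¬ (a = 0 ∧ b = 0)) (h₁ : ¬ (a = 2 ^ k ∧ b = 0))
    (h₂ : ¬ (a = 0 ∧ b = 2 ^ k))
    (h : IsSierpinskiCell k a b ∨ (1 ≤ a ∧ IsSierpinskiCell k (a - 1) b) ∨
      (1 ≤ b ∧ IsSierpinskiCell k a (b - 1))) :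
    (IsSierpinskiCell k a b ∧ 1 ≤ a ∧ IsSierpinskiCell k (a - 1) b) ∨
    (IsSierpinskiCell k a b ∧ 1 ≤ b ∧ IsSierpinskiCell k a (b - 1)) ∨
    (1 ≤ a ∧ IsSierpinskiCell k (a - 1) b ∧ 1 ≤ b ∧ IsSierpinskiCell k a (b - 1)) := by
  induction k generalizing a b with
  | zero => simp only [IsSierpinskiCell] at h; omega
  | succ k ih =>
    simp only [IsSierpinskiCell] at h ⊢
    rw [pow_succ] at h₁ h₂
    -- If both coordinates are even, all three candidate cells descend to the candidates at the
    -- halved point. Otherwise the point is the midpoint of a side in the refinement of the single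
    -- cell `(a / 2, b / 2)`, and two of its subcells contain it.
    rcases Nat.mod_two_eq_zero_or_one a with ha | ha <;>
      rcases Nat.mod_two_eq_zero_or_one b with hb | hb
    · have := ih (a := a / 2) (b := b / 2) (by omega) (by omega) (by omega)
      have e₁ : (a - 1) / 2 = a / 2 - 1 := by omega
      have e₂ : (b - 1) / 2 = b / 2 - 1 := by omega
      have e₃ : 1 ≤ a / 2 ↔ 1 ≤ a := by omega
      have e₄ : 1 ≤ b / 2 ↔ 1 ≤ b := by omega
      rw [e₃, e₄] at this
      rw [e₁, e₂] at h ⊢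
      simp only [ha, hb, zero_ne_one, and_false, false_and, not_false_iff, and_true] at h ⊢
      exact this h
    · have e₂ : (b - 1) / 2 = b / 2 := by omega
      have e₄ : (b - 1) % 2 = 0 := by omega
      have e₅ : 1 ≤ a → (a - 1) % 2 = 1 := by omega
      have e₆ : 1 ≤ b := by omega
      rw [e₂, e₄] at h ⊢
      simp only [ha, hb, zero_ne_one, and_true, and_false, not_false_iff] at h ⊢
      have hA : IsSierpinskiCell k (a / 2) (b / 2) := by
        rcases h with h | ⟨h, -, h'⟩ | ⟨-, h⟩
        exacts [h, absurd (e₅ h) h', h]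
      exact .inr (.inl ⟨hA, e₆, hA⟩)
    · have e₂ : (a - 1) / 2 = a / 2 := by omega
      have e₄ : (a - 1) % 2 = 0 := by omega
      have e₅ : 1 ≤ b → (b - 1) % 2 = 1 := by omega
      have e₆ : 1 ≤ a := by omega
      rw [e₂, e₄] at h ⊢
      simp only [ha, hb, zero_ne_one, and_false, true_and, not_false_iff, and_true] at h ⊢
      have hA : IsSierpinskiCell k (a / 2) (b / 2) := by
        rcases h with h | ⟨-, h⟩ | ⟨h, -, h'⟩
        exacts [h, h, absurd (e₅ h) h']
      exact .inl ⟨hA, e₆, hA⟩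
    · have e₁ : (a - 1) / 2 = a / 2 := by omega
      have e₂ : (b - 1) / 2 = b / 2 := by omega
      have e₃ : (a - 1) % 2 = 0 := by omega
      have e₄ : (b - 1) % 2 = 0 := by omega
      have e₅ : 1 ≤ a := by omega
      have e₆ : 1 ≤ b := by omega
      rw [e₁, e₂, e₃, e₄] at h ⊢
      simp only [ha, hb, zero_ne_one, and_false, false_and, and_self, not_true, not_false_iff,
        and_true, false_or] at h ⊢
      have hA : IsSierpinskiCell k (a / 2) (b / 2) := by
        rcases h with ⟨-, h⟩ | ⟨-, h⟩
        exacts [h, h]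
      exact ⟨e₅, hA, e₆, hA⟩

theorem zero_zero (k : ℕ) : IsSierpinskiCell k 0 0 := by
  induction k with
  | zero => exact ⟨rfl, rfl⟩
  | succ k ih => exact ⟨ih, by omega⟩

theorem sub_one_zero (k : ℕ) : IsSierpinskiCell k (2 ^ k - 1) 0 := by
  induction k with
  | zero => exact ⟨rfl, rfl⟩
  | succ k ih =>
    refine ⟨?_, by omega⟩
    have : (2 ^ (k + 1) - 1) / 2 = 2 ^ k - 1 := by rw [pow_succ]; omega
    rwa [this]

theorem zero_sub_one (k : ℕ) : IsSierpinskiCell k 0 (2 ^ k - 1) := by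
  induction k with
  | zero => exact ⟨rfl, rfl⟩
  | succ k ih =>
    refine ⟨?_, by omega⟩
    have : (2 ^ (k + 1) - 1) / 2 = 2 ^ k - 1 := by rw [pow_succ]; omega
    rwa [this]

end IsSierpinskiCell

/-! ### The gasket as a union of unit triangles. -/

/-- The vertex `p` belongs to the upward unit triangle with lower left vertex `t`. -/
def InUnitTriangle (t p : ℕ × ℕ) : Prop :=
  p = t ∨ p = (t.1 + 1, t.2) ∨ p = (t.1, t.2 + 1)

theorem inUnitTriangle_add {t p c : ℕ × ℕ} :
    InUnitTriangle (t + c) (p + c) ↔ InUnitTriangle t p := by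
  simp only [InUnitTriangle, Prod.ext_iff, Prod.fst_add, Prod.snd_add]
  omega

theorem isSierpinskiCell_succ_iff_exists {k : ℕ} {t : ℕ × ℕ} :
    IsSierpinskiCell (k + 1) t.1 t.2 ↔ IsSierpinskiCell k t.1 t.2 ∨
      (∃ s : ℕ × ℕ, IsSierpinskiCell k s.1 s.2 ∧ s + (2 ^ k, 0) = t) ∨
      (∃ s : ℕ × ℕ, IsSierpinskiCell k s.1 s.2 ∧ s + (0, 2 ^ k) = t) := by
  rw [IsSierpinskiCell.succ_iff]
  refine or_congr_right (or_congr ⟨fun h => ⟨(t.1 - 2 ^ k, t.2), h.2, ?_⟩, ?_⟩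
    ⟨fun h => ⟨(t.1, t.2 - 2 ^ k), h.2, ?_⟩, ?_⟩)
  · exact Prod.ext (Nat.sub_add_cancel h.1) rfl
  · rintro ⟨s, hs, rfl⟩
    exact ⟨Nat.le_add_left _ _, by simpa using hs⟩
  · exact Prod.ext rfl (Nat.sub_add_cancel h.1)
  · rintro ⟨s, hs, rfl⟩
    exact ⟨Nat.le_add_left _ _, by simpa using hs⟩

theorem mem_sierpinskiVerts_succ_iff {k : ℕ} {p : ℕ × ℕ} :
    p ∈ sierpinskiVerts (k + 1) ↔ ∃ t, IsSierpinskiCell k t.1 t.2 ∧ InUnitTriangle t p := by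
  induction k generalizing p with
  | zero =>
    simp only [sierpinskiVerts, IsSierpinskiCell, InUnitTriangle, Finset.mem_insert,
      Finset.mem_singleton]
    constructor
    · exact fun h => ⟨(0, 0), ⟨rfl, rfl⟩, h⟩
    · rintro ⟨⟨a, b⟩, ⟨h₁, h₂⟩, h⟩
      dsimp only at h₁ h₂
      subst h₁ h₂
      exact h
  | succ k ih =>
    simp only [sierpinskiVerts, Finset.mem_union, Finset.mem_map, ih, addRightEmbedding_apply,
      isSierpinskiCell_succ_iff_exists]
    constructor
    · rintro ((⟨t, ht, h⟩ | ⟨q, ⟨t, ht, h⟩, rfl⟩) | ⟨q, ⟨t, ht, h⟩, rfl⟩)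
      · exact ⟨t, .inl ht, h⟩
      · exact ⟨_, .inr (.inl ⟨t, ht, rfl⟩), inUnitTriangle_add.2 h⟩
      · exact ⟨_, .inr (.inr ⟨t, ht, rfl⟩), inUnitTriangle_add.2 h⟩
    · rintro ⟨t, ht | ⟨s, hs, rfl⟩ | ⟨s, hs, rfl⟩, h⟩
      · exact .inl (.inl ⟨t, ht, h⟩)
      · refine .inl (.inr ?_)
        rcases h with rfl | rfl | rfl
        · exact ⟨s, ⟨s, hs, .inl rfl⟩, rfl⟩
        · exact ⟨(s.1 + 1, s.2), ⟨s, hs, .inr (.inl rfl)⟩, by ext <;> simp; omega⟩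
        · exact ⟨(s.1, s.2 + 1), ⟨s, hs, .inr (.inr rfl)⟩, by ext <;> simp⟩
      · refine .inr ?_
        rcases h with rfl | rfl | rfl
        · exact ⟨s, ⟨s, hs, .inl rfl⟩, rfl⟩
        · exact ⟨(s.1 + 1, s.2), ⟨s, hs, .inr (.inl rfl)⟩, by ext <;> simp⟩
        · exact ⟨(s.1, s.2 + 1), ⟨s, hs, .inr (.inr rfl)⟩, by ext <;> simp; omega⟩

theorem InUnitTriangle.exists_add_eq {t c p : ℕ × ℕ} (h : InUnitTriangle (t + c) p) :
    ∃ q, q + c = p ∧ InUnitTriangle t q := by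
  rcases h with rfl | rfl | rfl
  · exact ⟨t, rfl, .inl rfl⟩
  · exact ⟨(t.1 + 1, t.2), by ext <;> simp; omega, .inr (.inl rfl)⟩
  · exact ⟨(t.1, t.2 + 1), by ext <;> simp; omega, .inr (.inr rfl)⟩

theorem sierpinskiEdges_succ_adj_iff {k : ℕ} {p q : ℕ × ℕ} :
    (sierpinskiEdges (k + 1)).Adj p q ↔
      p ≠ q ∧ ∃ t, IsSierpinskiCell k t.1 t.2 ∧ InUnitTriangle t p ∧ InUnitTriangle t q := by
  induction k generalizing p q with
  | zero =>
    simp only [sierpinskiEdges, SimpleGraph.fromRel_adj, mem_sierpinskiVerts_succ_iff,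
      IsSierpinskiCell]
    refine and_congr_right fun _ => ⟨?_, ?_⟩
    · rintro (⟨⟨⟨a, b⟩, ⟨h₁, h₂⟩, h⟩, ⟨c, d⟩, ⟨h₃, h₄⟩, h'⟩ |
        ⟨⟨⟨a, b⟩, ⟨h₁, h₂⟩, h'⟩, ⟨c, d⟩, ⟨h₃, h₄⟩, h⟩) <;>
      · dsimp only at h₁ h₂ h₃ h₄
        subst h₁ h₂ h₃ h₄
        exact ⟨(0, 0), ⟨rfl, rfl⟩, h, h'⟩
    · rintro ⟨t, ht, h, h'⟩
      exact .inl ⟨⟨t, ht, h⟩, t, ht, h'⟩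
  | succ k ih =>
    simp only [sierpinskiEdges, SimpleGraph.sup_adj, SimpleGraph.map_adj, ih,
      addRightEmbedding_apply, isSierpinskiCell_succ_iff_exists]
    constructor
    · rintro ((⟨hne, t, ht, h, h'⟩ | ⟨x, y, ⟨hne, t, ht, h, h'⟩, rfl, rfl⟩) |
        ⟨x, y, ⟨hne, t, ht, h, h'⟩, rfl, rfl⟩)
      · exact ⟨hne, t, .inl ht, h, h'⟩
      · exact ⟨fun h => hne (add_right_cancel h), _, .inr (.inl ⟨t, ht, rfl⟩),
          inUnitTriangle_add.2 h, inUnitTriangle_add.2 h'⟩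
      · exact ⟨fun h => hne (add_right_cancel h), _, .inr (.inr ⟨t, ht, rfl⟩),
          inUnitTriangle_add.2 h, inUnitTriangle_add.2 h'⟩
    · rintro ⟨hne, t, ht | ⟨s, hs, rfl⟩ | ⟨s, hs, rfl⟩, h, h'⟩
      · exact .inl (.inl ⟨hne, t, ht, h, h'⟩)
      · obtain ⟨x, rfl, hx⟩ := h.exists_add_eq
        obtain ⟨y, rfl, hy⟩ := h'.exists_add_eq
        exact .inl (.inr ⟨x, y, ⟨fun h => hne (h ▸ rfl), s, hs, hx, hy⟩, rfl, rfl⟩)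
      · obtain ⟨x, rfl, hx⟩ := h.exists_add_eq
        obtain ⟨y, rfl, hy⟩ := h'.exists_add_eq
        exact .inr ⟨x, y, ⟨fun h => hne (h ▸ rfl), s, hs, hx, hy⟩, rfl, rfl⟩

/-! ### Block decomposition of the gasket. -/

/-- The type of cells of the Sierpinski gasket of side length `2 ^ k`. -/
def SierpinskiCell (k : ℕ) : Type := {t : ℕ × ℕ // IsSierpinskiCell k t.1 t.2}

/-- The corners of the unit triangle at the origin. -/
def unitCorner (i : Fin 3) : ℕ × ℕ := (if i = 1 then 1 else 0, if i = 2 then 1 else 0)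

theorem inUnitTriangle_iff {t p : ℕ × ℕ} : InUnitTriangle t p ↔ ∃ i, p = t + unitCorner i := by
  simp [InUnitTriangle, unitCorner, Prod.ext_iff, Fin.exists_fin_succ]

/-- The sum of the two corners of the unit triangle other than the given one. -/
def unitMid (i : Fin 3) : ℕ × ℕ := (if i = 1 then 0 else 1, if i = 2 then 0 else 1)

theorem unitCorner_add {i j k : Fin 3} (hij : i ≠ j) (hik : i ≠ k) (hjk : j ≠ k) :
    unitCorner i + unitCorner j = unitMid k := by
  revert i j k
  decide

theorem exists_ne_ne (i j : Fin 3) : ∃ l, i ≠ l ∧ j ≠ l := by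
  revert i j
  decide

/-- The lowest digits, of which at most one is `1`, select one of the three subcells of the halved
cell. -/
theorem isSierpinskiCell_succ_iff_exists_two_mul {k : ℕ} {s : ℕ × ℕ} :
    IsSierpinskiCell (k + 1) s.1 s.2 ↔
      ∃ (t : SierpinskiCell k) (j : Fin 3), s = 2 * t.1 + unitCorner j := by
  constructor
  · rintro ⟨h, hp⟩
    have h₁ := Nat.div_add_mod s.1 2
    have h₂ := Nat.div_add_mod s.2 2
    refine ⟨⟨(s.1 / 2, s.2 / 2), h⟩, if s.1 % 2 = 1 then 1 else if s.2 % 2 = 1 then 2 else 0, ?_⟩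
    ext <;> simp only [unitCorner, Prod.fst_add, Prod.snd_add, Prod.fst_mul, Prod.snd_mul,
      Prod.fst_ofNat, Prod.snd_ofNat] <;> split_ifs <;> simp_all
  · rintro ⟨⟨⟨a, b⟩, h⟩, j, rfl⟩
    simp only [IsSierpinskiCell, unitCorner, Prod.fst_add, Prod.snd_add, Prod.fst_mul, Prod.snd_mul,
      Prod.fst_ofNat, Prod.snd_ofNat]
    have h₁ : (2 * a + if j = 1 then 1 else 0) / 2 = a := by split_ifs <;> omega
    have h₂ : (2 * b + if j = 2 then 1 else 0) / 2 = b := by split_ifs <;> omega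
    rw [h₁, h₂]
    refine ⟨h, ?_⟩
    split_ifs <;> omega

namespace SierpinskiCell

variable {k : ℕ}

/-- The corner with index `j` of the block that refines the cell `t`. -/
def corner (t : SierpinskiCell k) (j : Fin 3) : ℕ × ℕ := 2 * (t.1 + unitCorner j)

/-- The midpoint opposite to the corner with index `j` of the block that refines the cell `t`. -/
def mid (t : SierpinskiCell k) (j : Fin 3) : ℕ × ℕ := 2 * t.1 + unitMid j

theorem inUnitTriangle_iff_corner_or_mid {t : SierpinskiCell k} {j : Fin 3} {p : ℕ × ℕ} :
    InUnitTriangle (2 * t.1 + unitCorner j) p ↔ p = corner t j ∨ ∃ i, i ≠ j ∧ p = mid t i := by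
  rw [inUnitTriangle_iff]
  have aux : 2 * t.1 + unitCorner j + unitCorner j = corner t j := by
    rw [corner, mul_add, add_assoc, two_mul (unitCorner j)]
  constructor
  · rintro ⟨i, rfl⟩
    by_cases hij : i = j
    · exact .inl (hij ▸ aux)
    · obtain ⟨l, hl₁, hl₂⟩ := exists_ne_ne j i
      exact .inr ⟨l, hl₁.symm, by rw [add_assoc, unitCorner_add (Ne.symm hij) hl₁ hl₂, mid]⟩
  · rintro (rfl | ⟨i, hij, rfl⟩)
    · exact ⟨j, aux.symm⟩
    · obtain ⟨l, hl₁, hl₂⟩ := exists_ne_ne j i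
      exact ⟨l, by rw [add_assoc, unitCorner_add hl₁ hij.symm hl₂.symm, mid]⟩

/-- Corners have two even coordinates; a midpoint has an odd one. -/
theorem corner_ne_mid (s : SierpinskiCell k) (j : Fin 3) (t : SierpinskiCell k) (i : Fin 3) :
    corner s j ≠ mid t i := by
  intro h
  rw [corner, mid, Prod.ext_iff] at h
  simp only [unitMid, Prod.fst_add, Prod.snd_add, Prod.fst_mul, Prod.snd_mul,
      Prod.fst_ofNat, Prod.snd_ofNat] at h
  split_ifs at h <;> omega

theorem mid_inj {s : SierpinskiCell k} {j : Fin 3} {t : SierpinskiCell k} {i : Fin 3}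
    (h : mid s j = mid t i) : s = t ∧ j = i := by
  rw [mid, mid, Prod.ext_iff] at h
  simp only [unitMid, Prod.fst_add, Prod.snd_add, Prod.fst_mul, Prod.snd_mul,
      Prod.fst_ofNat, Prod.snd_ofNat] at h
  have : s.1.1 = t.1.1 ∧ s.1.2 = t.1.2 ∧ j = i := by
    split_ifs at h <;> omega
  exact ⟨Subtype.ext (Prod.ext this.1 this.2.1), this.2.2⟩

theorem corner_eq_corner_iff {s : SierpinskiCell k} {j : Fin 3} {t : SierpinskiCell k}
    {i : Fin 3} : corner s j = corner t i ↔ s.1 + unitCorner j = t.1 + unitCorner i := by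
  refine ⟨fun h => ?_, fun h => by rw [corner, corner, h]⟩
  rw [corner, corner, Prod.ext_iff] at h
  simp only [Prod.fst_mul, Prod.snd_mul, Prod.fst_ofNat, Prod.snd_ofNat] at h
  exact Prod.ext (by omega) (by omega)

theorem mem_sierpinskiVerts_iff {p : ℕ × ℕ} : p ∈ sierpinskiVerts (k + 2) ↔
    ∃ (t : SierpinskiCell k) (j : Fin 3), p = corner t j ∨ p = mid t j := by
  rw [mem_sierpinskiVerts_succ_iff]
  simp only [isSierpinskiCell_succ_iff_exists_two_mul]
  constructor
  · rintro ⟨_, ⟨t, j, rfl⟩, h⟩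
    rcases inUnitTriangle_iff_corner_or_mid.1 h with h | ⟨i, -, h⟩
    exacts [⟨t, j, .inl h⟩, ⟨t, i, .inr h⟩]
  · rintro ⟨t, j, h | h⟩
    · exact ⟨_, ⟨t, j, rfl⟩, inUnitTriangle_iff_corner_or_mid.2 (.inl h)⟩
    -- `mid t j` lies in the subcells at the two corners other than `j`; `j + 1` is one of them.
    · exact ⟨_, ⟨t, j + 1, rfl⟩, inUnitTriangle_iff_corner_or_mid.2 (.inr ⟨j, by omega, h⟩)⟩

theorem sierpinskiEdges_adj_iff {p q : ℕ × ℕ} : (sierpinskiEdges (k + 2)).Adj p q ↔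
    p ≠ q ∧ ∃ (t : SierpinskiCell k) (j : Fin 3), (p = corner t j ∨ ∃ i, i ≠ j ∧ p = mid t i) ∧
      (q = corner t j ∨ ∃ i, i ≠ j ∧ q = mid t i) := by
  rw [sierpinskiEdges_succ_adj_iff]
  simp only [isSierpinskiCell_succ_iff_exists_two_mul]
  refine and_congr_right fun _ => ⟨?_, ?_⟩
  · rintro ⟨_, ⟨t, j, rfl⟩, h, h'⟩
    exact ⟨t, j, inUnitTriangle_iff_corner_or_mid.1 h, inUnitTriangle_iff_corner_or_mid.1 h'⟩
  · rintro ⟨t, j, h, h'⟩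
    exact ⟨_, ⟨t, j, rfl⟩, inUnitTriangle_iff_corner_or_mid.2 h,
      inUnitTriangle_iff_corner_or_mid.2 h'⟩

theorem adj_mid_mid (s : SierpinskiCell k) (j : Fin 3) (t : SierpinskiCell k) (i : Fin 3) :
    (sierpinskiEdges (k + 2)).Adj (mid s j) (mid t i) ↔ s = t ∧ j ≠ i := by
  rw [sierpinskiEdges_adj_iff]
  constructor
  · rintro ⟨hne, r, l, h | ⟨x, hx, h⟩, h' | ⟨y, hy, h'⟩⟩
    · exact absurd h.symm (corner_ne_mid _ _ _ _)
    · exact absurd h.symm (corner_ne_mid _ _ _ _)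
    · exact absurd h'.symm (corner_ne_mid _ _ _ _)
    · obtain ⟨rfl, rfl⟩ := mid_inj h
      obtain ⟨rfl, rfl⟩ := mid_inj h'
      exact ⟨rfl, fun h => hne (h ▸ rfl)⟩
  · rintro ⟨rfl, hij⟩
    obtain ⟨l, hl₁, hl₂⟩ := exists_ne_ne j i
    exact ⟨fun h => hij (mid_inj h).2, s, l, .inr ⟨j, hl₁, rfl⟩, .inr ⟨i, hl₂, rfl⟩⟩

theorem adj_corner_mid (s : SierpinskiCell k) (j : Fin 3) (t : SierpinskiCell k) (i : Fin 3) :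
    (sierpinskiEdges (k + 2)).Adj (corner s j) (mid t i) ↔
      ∃ l, l ≠ i ∧ corner t l = corner s j := by
  rw [sierpinskiEdges_adj_iff]
  constructor
  · rintro ⟨-, r, l, h | ⟨x, hx, h⟩, h' | ⟨y, hy, h'⟩⟩
    · exact absurd h'.symm (corner_ne_mid _ _ _ _)
    · obtain ⟨rfl, rfl⟩ := mid_inj h'
      exact ⟨l, hy.symm, h.symm⟩
    · exact absurd h (corner_ne_mid _ _ _ _)
    · exact absurd h (corner_ne_mid _ _ _ _)
  · rintro ⟨l, hl, h⟩
    exact ⟨corner_ne_mid _ _ _ _, t, l, .inl h.symm, .inr ⟨i, hl.symm, rfl⟩⟩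

theorem not_adj_corner_corner (s : SierpinskiCell k) (j : Fin 3) (t : SierpinskiCell k)
    (i : Fin 3) : ¬ (sierpinskiEdges (k + 2)).Adj (corner s j) (corner t i) := by
  rw [sierpinskiEdges_adj_iff]
  rintro ⟨hne, r, l, h | ⟨x, hx, h⟩, h' | ⟨y, hy, h'⟩⟩
  · exact hne (h.trans h'.symm)
  · exact absurd h' (corner_ne_mid _ _ _ _)
  · exact absurd h (corner_ne_mid _ _ _ _)
  · exact absurd h (corner_ne_mid _ _ _ _)

theorem corner_inj {t : SierpinskiCell k} {i j : Fin 3} (h : corner t i = corner t j) :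
    i = j := by
  rw [corner_eq_corner_iff, add_right_inj] at h
  revert i j
  decide

theorem eq_of_corner_eq {s t : SierpinskiCell k} {j j' i i' : Fin 3} (hj : j ≠ j')
    (h : corner s j = corner t i) (h' : corner s j' = corner t i') : s = t := by
  rw [corner_eq_corner_iff, Prod.ext_iff] at h h'
  simp only [unitCorner, Prod.fst_add, Prod.snd_add] at h h'
  apply Subtype.ext
  ext <;> split_ifs at h h' <;> omega

theorem eq_of_three {r s t : SierpinskiCell k} {i j l : Fin 3} (h : corner r i = corner t l)
    (h' : corner s j = corner t l) : r = s ∨ s = t ∨ r = t := by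
  rw [corner_eq_corner_iff] at h h'
  by_contra! hne
  obtain ⟨h₁, h₂, h₃⟩ := hne
  have hij : i ≠ j := by
    rintro rfl
    exact h₁ (Subtype.ext (add_right_cancel (h.trans h'.symm)))
  have hjl : j ≠ l := by
    rintro rfl
    exact h₂ (Subtype.ext (add_right_cancel h'))
  have hil : i ≠ l := by
    rintro rfl
    exact h₃ (Subtype.ext (add_right_cancel h))
  -- Distinct cells meet a common point in corners of distinct index, so three of them use up all
  -- indices and give the configuration excluded by `not_three`.
  have key : ∀ m : Fin 3, ∃ u : SierpinskiCell k, u.1 + unitCorner m = t.1 + unitCorner l := by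
    intro m
    have : m = i ∨ m = j ∨ m = l := by omega
    rcases this with rfl | rfl | rfl
    exacts [⟨r, h⟩, ⟨s, h'⟩, ⟨t, rfl⟩]
  obtain ⟨⟨⟨a, b⟩, hu⟩, hu'⟩ := key 0
  obtain ⟨⟨⟨c, d⟩, hv⟩, hv'⟩ := key 1
  obtain ⟨⟨⟨e, g⟩, hw⟩, hw'⟩ := key 2
  rw [← hu', Prod.ext_iff] at hv' hw'
  simp only [unitCorner, Prod.fst_add, Prod.snd_add] at hv' hw' hu hv hw
  norm_num at hv' hw'
  obtain ⟨rfl, rfl⟩ := hv'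
  obtain ⟨rfl, rfl⟩ := hw'
  exact IsSierpinskiCell.not_three hu hv hw

end SierpinskiCell

namespace SierpinskiCell

variable {k : ℕ}

theorem corner_mem (t : SierpinskiCell k) (j : Fin 3) : corner t j ∈ sierpinskiVerts (k + 2) :=
  mem_sierpinskiVerts_iff.2 ⟨t, j, .inl rfl⟩

theorem mid_mem (t : SierpinskiCell k) (j : Fin 3) : mid t j ∈ sierpinskiVerts (k + 2) :=
  mem_sierpinskiVerts_iff.2 ⟨t, j, .inr rfl⟩

/-- The decomposition of a Sierpinski gasket graph into copies of the gasket of side length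
two. -/
def blocks (k : ℕ) : (sierpinskiGasket (k + 2)).TriangleBlocks (SierpinskiCell k) where
  corner t j := ⟨corner t j, corner_mem t j⟩
  mid t j := ⟨mid t j, mid_mem t j⟩
  exists_eq v := by
    obtain ⟨t, j, h⟩ := mem_sierpinskiVerts_iff.1 v.2
    exact ⟨t, j, h.imp Subtype.ext Subtype.ext⟩
  corner_ne_mid s j t i h := corner_ne_mid s j t i (congrArg Subtype.val h)
  mid_inj _ _ _ _ h := mid_inj (congrArg Subtype.val h)
  corner_inj _ _ _ h := corner_inj (congrArg Subtype.val h)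
  block_eq _ _ _ _ _ _ hj h h' :=
    eq_of_corner_eq hj (congrArg Subtype.val h) (congrArg Subtype.val h')
  block_eq_of_three _ _ _ _ _ _ h h' :=
    eq_of_three (congrArg Subtype.val h) (congrArg Subtype.val h')
  adj_mid_mid := adj_mid_mid
  adj_corner_mid s j t i := (adj_corner_mid s j t i).trans (by simp only [Subtype.mk.injEq])
  not_adj_corner_corner := not_adj_corner_corner

/-! ### Outer corners of the gasket. -/

/-- The point `p` is one of the three corners of the triangle of side length `m`. -/
def IsTriangleCorner (m : ℕ) (p : ℕ × ℕ) : Prop := p = (0, 0) ∨ p = (m, 0) ∨ p = (0, m)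

theorem isTriangleCorner_two_mul {m : ℕ} {p : ℕ × ℕ} :
    IsTriangleCorner (2 * m) (2 * p) ↔ IsTriangleCorner m p := by
  simp only [IsTriangleCorner, Prod.ext_iff, Prod.fst_mul, Prod.snd_mul, Prod.fst_ofNat,
    Prod.snd_ofNat]
  omega

theorem shared_iff {t : SierpinskiCell k} {j : Fin 3} :
    (blocks k).Shared t j ↔ ∃ (s : SierpinskiCell k) (i : Fin 3), s ≠ t ∧
      s.1 + unitCorner i = t.1 + unitCorner j := by
  simp only [SimpleGraph.TriangleBlocks.Shared, blocks, Subtype.mk.injEq, corner_eq_corner_iff]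

/-- A point other than the three extreme ones lies in a second cell by `two_of_one`. Conversely,
`add_lt` leaves room for only one cell at each extreme point. -/
theorem not_shared_iff {t : SierpinskiCell k} {j : Fin 3} :
    ¬ (blocks k).Shared t j ↔ IsTriangleCorner (2 ^ k) (t.1 + unitCorner j) := by
  rw [shared_iff]
  constructor
  · intro h
    by_contra hc
    obtain ⟨⟨a, b⟩, hp⟩ : ∃ p, p = t.1 + unitCorner j := ⟨_, rfl⟩
    rw [← hp] at h hc
    simp only [IsTriangleCorner, Prod.mk.injEq, not_or] at hc
    have h₀ : IsSierpinskiCell k a b → ∃ s : SierpinskiCell k, s.1 + unitCorner 0 = (a, b) :=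
      fun h => ⟨⟨(a, b), h⟩, by simp [unitCorner]⟩
    have h₁ : 1 ≤ a → IsSierpinskiCell k (a - 1) b →
        ∃ s : SierpinskiCell k, s.1 + unitCorner 1 = (a, b) :=
      fun ha h => ⟨⟨(a - 1, b), h⟩, by simp [unitCorner, ha]⟩
    have h₂ : 1 ≤ b → IsSierpinskiCell k a (b - 1) →
        ∃ s : SierpinskiCell k, s.1 + unitCorner 2 = (a, b) :=
      fun hb h => ⟨⟨(a, b - 1), h⟩, by simp [unitCorner, hb]⟩
    have key : ∃ i i' : Fin 3, i ≠ i' ∧ (∃ s : SierpinskiCell k, s.1 + unitCorner i = (a, b)) ∧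
        ∃ s : SierpinskiCell k, s.1 + unitCorner i' = (a, b) := by
      rcases IsSierpinskiCell.two_of_one hc.1 hc.2.1 hc.2.2 (by
        have ht := t.2
        rw [Prod.ext_iff] at hp
        simp only [unitCorner, Prod.fst_add, Prod.snd_add] at hp
        obtain ⟨rfl, rfl⟩ := hp
        have : j = 0 ∨ j = 1 ∨ j = 2 := by omega
        rcases this with rfl | rfl | rfl
        · exact .inl (by simpa using ht)
        · exact .inr (.inl (by simpa using ht))
        · exact .inr (.inr (by simpa using ht))) with ⟨h, ha, h'⟩ | ⟨h, hb, h'⟩ | ⟨ha, h, hb, h'⟩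
      · exact ⟨0, 1, by decide, h₀ h, h₁ ha h'⟩
      · exact ⟨0, 2, by decide, h₀ h, h₂ hb h'⟩
      · exact ⟨1, 2, by decide, h₁ ha h, h₂ hb h'⟩
    obtain ⟨i, i', hi, ⟨s, hs⟩, s', hs'⟩ := key
    by_cases hst : s = t
    · refine h ⟨s', i', fun h' => hi ?_, hs'⟩
      have hs₂ := corner_eq_corner_iff.2 (hs.trans hs'.symm)
      rw [hst, h'] at hs₂
      exact corner_inj hs₂
    · exact h ⟨s, i, hst, hs⟩
  · rintro h ⟨⟨⟨a, b⟩, hs⟩, i, hst, he⟩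
    obtain ⟨⟨c, d⟩, ht⟩ := t
    have hs' := hs.add_lt
    have ht' := ht.add_lt
    refine hst (Subtype.ext ?_)
    simp only [IsTriangleCorner, unitCorner, Prod.ext_iff, Prod.fst_add,
      Prod.snd_add] at h he hs' ht' ⊢
    split_ifs at h he <;> simp only [false_and, and_false, false_or, or_false, add_zero] at h <;>
    omega

/-- The large triangle has side at least two, so a unit cell cannot contain two of its corners. The
index `k + 1` is where `n ≥ 3` enters. -/
theorem shared_or_shared (t : SierpinskiCell (k + 1)) (i j : Fin 3) (hij : i ≠ j) :
    (blocks (k + 1)).Shared t i ∨ (blocks (k + 1)).Shared t j := by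
  by_contra! h
  rw [not_shared_iff, not_shared_iff] at h
  have : 0 < 2 ^ k := by positivity
  simp only [IsTriangleCorner, unitCorner, Prod.ext_iff, Prod.fst_add, Prod.snd_add, pow_succ] at h
  split_ifs at h <;> simp only [false_and, and_false, false_or, or_false, add_zero] at h <;> omega

theorem mem_outerCorners_iff {v : sierpinskiVerts (k + 2)} :
    v ∈ (blocks k).outerCorners ↔ IsTriangleCorner (2 ^ (k + 1)) v := by
  simp only [SimpleGraph.TriangleBlocks.outerCorners, Set.mem_ofPred_eq, not_shared_iff]
  rw [pow_succ']
  constructor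
  · rintro ⟨t, j, h, rfl⟩
    exact isTriangleCorner_two_mul.2 h
  · intro h
    have : 1 ≤ 2 ^ k := Nat.one_le_two_pow
    obtain ⟨t, j, hv⟩ : ∃ (t : SierpinskiCell k) (j : Fin 3), v.1 = corner t j := by
      rcases h with h | h | h
      · exact ⟨⟨(0, 0), IsSierpinskiCell.zero_zero k⟩, 0, by
          rw [h]; simp [corner, unitCorner, Prod.ext_iff]⟩
      · exact ⟨⟨(2 ^ k - 1, 0), IsSierpinskiCell.sub_one_zero k⟩, 1, by
          rw [h]; simp [corner, unitCorner, Prod.ext_iff, this]⟩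
      · exact ⟨⟨(0, 2 ^ k - 1), IsSierpinskiCell.zero_sub_one k⟩, 2, by
          rw [h]; simp [corner, unitCorner, Prod.ext_iff, this]⟩
    rw [hv, corner, isTriangleCorner_two_mul] at h
    exact ⟨t, j, h, Subtype.ext hv⟩

theorem ncard_outerCorners : (blocks k).outerCorners.ncard = 3 := by
  have hpos : 2 ^ (k + 1) ≠ 0 := by positivity
  have himg : Subtype.val '' (blocks k).outerCorners =
      {((0 : ℕ), (0 : ℕ)), (2 ^ (k + 1), 0), (0, 2 ^ (k + 1))} := by
    ext p
    simp only [Set.mem_image, mem_outerCorners_iff, Set.mem_insert_iff, Set.mem_singleton_iff]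
    constructor
    · rintro ⟨v, h, rfl⟩
      exact h
    · intro h
      refine ⟨⟨p, ?_⟩, h, rfl⟩
      rw [mem_sierpinskiVerts_succ_iff]
      have h1 : 1 ≤ 2 ^ (k + 1) := Nat.one_le_two_pow
      rcases h with rfl | rfl | rfl
      · exact ⟨(0, 0), IsSierpinskiCell.zero_zero _, .inl rfl⟩
      · exact ⟨(2 ^ (k + 1) - 1, 0), IsSierpinskiCell.sub_one_zero _, .inr (.inl (by simp [h1]))⟩
      · exact ⟨(0, 2 ^ (k + 1) - 1), IsSierpinskiCell.zero_sub_one _, .inr (.inr (by simp [h1]))⟩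
  rw [← Set.InjOn.ncard_image Subtype.val_injective.injOn, himg, Set.ncard_eq_three]
  refine ⟨_, _, _, ?_, ?_, ?_, rfl⟩ <;> simp [hpos.symm]

theorem cornerCliques_eq_image :
    sierpinskiCornerCliques (k + 2) =
      (sierpinskiGasket (k + 2)).closedNbhd '' (blocks k).outerCorners := by
  ext C
  simp only [Set.mem_image, mem_outerCorners_iff]
  exact exists_congr fun v => and_congr_right fun _ => eq_comm

end SierpinskiCell

/-! ### The main theorem. -/

theorem mainTheorem4 {F : Type*} [Field F] (n : ℕ) (hn : 3 ≤ n) :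
    (sierpinskiGasket n).wcdim F = 3 ∧
    (sierpinskiGasket n).sc = 3 ∧
    (sierpinskiGasket n).simplicialCliques = sierpinskiCornerCliques n ∧
    ∀ f : sierpinskiVerts n → F, (sierpinskiGasket n).IsWellCoveredWeighting f →
      (∀ v, (∀ C ∈ sierpinskiCornerCliques n, v ∉ C) → f v = 0) ∧
      (∀ C ∈ sierpinskiCornerCliques n, ∀ u ∈ C, ∀ v ∈ C, f u = f v) := by
  obtain ⟨k, rfl⟩ : ∃ k, n = k + 1 + 2 := ⟨n - 3, by omega⟩
  let B := SierpinskiCell.blocks (k + 1)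
  have hB := SierpinskiCell.shared_or_shared (k := k)
  have hcard : B.outerCorners.ncard = 3 := SierpinskiCell.ncard_outerCorners
  rw [SierpinskiCell.cornerCliques_eq_image]
  refine ⟨(B.wcdim_eq_ncard hB).trans hcard, B.sc_eq_ncard.trans hcard,
    B.simplicialCliques_eq_image, fun f hf => ⟨fun v hv => ?_, ?_⟩⟩
  · exact B.eq_zero_of_forall_notMem hB hf fun w hw => hv _ ⟨w, hw, rfl⟩
  · rintro _ ⟨w, hw, rfl⟩ u hu v hv
    rw [B.eq_of_mem_closedNbhd_outerCorner hB hf hw hu,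
      B.eq_of_mem_closedNbhd_outerCorner hB hf hw hv]
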